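/- Let $G:\mathbb R^n\rightrightarrows\mathbb R^n$ be maximal monotone and fix $x\in\mathbb R^d$. Let $W,\Delta W,U,b$ depend on a scalar parameter $\vartheta$, put $\widetilde W=W+\Delta W$, and suppose that $\widetilde W$, $U$, $b$ are differentiable at $\vartheta_0$. For $\vartheta$ near $\vartheta_0$ let $\widetilde z(\vartheta)$ solve $0\in\widetilde F(z)+G(z)$, where $\widetilde F(z)=(I-\widetilde W)z-(Ux+b)$, and suppose that $\widetilde p:=\frac{d\widetilde z}{d\vartheta}(\vartheta_0)$ exists. Put $\widetilde r:=\frac{d\widetilde W}{d\vartheta}\widetilde z+\frac{dU}{d\vartheta}x+\frac{db}{d\vartheta}$; from now on everything is evaluated at $\vartheta_0$. Let $\operatorname{sym}(A)=\frac12(A+A^\top)$, $m=\lambda_{\min}(\operatorname{sym}(I-W))$, $L=\|I-W\|_2$, $\widetilde m=\lambda_{\min}(\operatorname{sym}(I-\widetilde W))$, $\widetilde L=\|I-\widetilde W\|_2$, and let $J_{\alpha T}=(I+\alpha T)^{-1}$ denote resolvents. For $T$ monotone and $F$ affine, say that *splitting for $0\in F(q)+T(q)$ converges to $q$ with constants $(\widetilde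 m,\widetilde L)$* if $q$ is its unique solution, $F$ is $\widetilde m$-strongly monotone and $\widetilde L$-Lipschitz, the resolvents $J_{\alpha T},J_{\alpha F}$ are single-valued and everywhere defined for all $\alpha>0$, and * (forward–backward) for $0<\alpha<2\widetilde m/\widetilde L^2$ the map $J_{\alpha T}(I-\alpha F)$ is a contraction with modulus $\sqrt{1-2\alpha\widetilde m+\alpha^2\widetilde L^2}<1$, and its iterates from any starting point converge linearly with this modulus to $q$; * (Peaceman–Rachford) for all $\alpha>0$ the map $(2J_{\alpha T}-I)(2J_{\alpha F}-I)$ is a contraction with modulus $\sqrt{1-4\alpha\widetilde m/(1+\alpha\widetilde L)^2}<1$, its iterates $w^k$ from any starting point converge linearly with this modulus to $q+\alpha F(q)$, and $J_{\alpha F}(w^k)\to q=J_{\alpha F}(q+\alpha F(q))$. **Theorem.** One has $\widetilde m\ge m-\|\Delta W\|_2$ and $|L-\|\Delta W\|_2|\le\widetilde L\le L+\|\Delta W\|_2$; in particular $\|\Delta W\|_2<m$ implies $\widetilde m>0$. If $\widetilde m>0$ (in particular if $\|\Delta W\|_2<m$), then: 1. *Forward pass.* Splitting for $0\in\widetilde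 F(z)+G(z)$ converges to $\widetilde z$ with constants $(\widetilde m,\widetilde L)$. 2. *Backward pass.* Suppose that near $\widetilde z$ the operator $G$ is single-valued and Lipschitz, and let $\partial_CG(\widetilde z)$ be its Clarke generalized Jacobian (the convex hull of the limits of $G'(z_k)$ along points of differentiability $z_k\to\widetilde z$). Every element of $\partial_CG(\widetilde z)$ has positive semidefinite symmetric part, and there is $\widetilde G_b\in\partial_CG(\widetilde z)$ such that $$0\in(I-\widetilde W)\widetilde p-\widetilde r+\widetilde G_b(\widetilde p),$$ and splitting for this inclusion converges to $\widetilde p$ with constants $(\widetilde m,\widetilde L)$. Moreover, for every $\widetilde G_b\in\partial_CG(\widetilde z)$ splitting for the inclusion $0\in(I-\widetilde W)q-\widetilde r+\widetilde G_b(q)$ converges to its unique solution $q$ with constants $(\widetilde m,\widetilde L)$. 3. *Backward pass, set-valued $G$.* Let $G$ be an arbitrary maximal monotone operator and $\beta>0$. Then $J_{\beta G}$ is single-valued and everywhere defined, and the conclusions of 2 hold with "$\widetilde G_b\in\partial_CG(\widetilde z)$" replaced by "$\widetilde G_b=\beta^{-1}(D^{-1}-I)$ (a set-valued linear operator) with $D\in\partial_CJ_{\beta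 G}(\widetilde z-\beta\widetilde F(\widetilde z))$" and "positive semidefinite symmetric part" replaced by "monotone". -/

import Mathlib

open Filter Topology
open scoped Matrix.Norms.L2Operator

noncomputable section

namespace MonDEQ

/-- The Euclidean space `ℝⁿ`. -/
abbrev E (n : ℕ) := EuclideanSpace ℝ (Fin n)

variable {n : ℕ}

/-! Set-valued operators `G : ℝⁿ ⇉ ℝⁿ` are functions `E n → Set (E n)`. -/

/-- Monotonicity of a set-valued operator. -/
def IsMonotoneOp (G : E n → Set (E n)) : Prop :=
  ∀ x y : E n, ∀ u ∈ G x, ∀ v ∈ G y, 0 ≤ inner ℝ (u - v) (x - y)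

/-- Maximal monotonicity: the graph is not properly contained in the graph of another
monotone operator. -/
def IsMaximalMonotoneOp (G : E n → Set (E n)) : Prop :=
  IsMonotoneOp G ∧ ∀ H : E n → Set (E n), IsMonotoneOp H → (∀ x, G x ⊆ H x) → H = G

/-- A single-valued map regarded as a set-valued operator. -/
def single (F : E n → E n) : E n → Set (E n) := fun z => {F z}

/-- The inclusion `0 ∈ F(z) + G(z)`, with `F` single-valued and `G` set-valued. -/
def SolvesInclusion (F : E n → E n) (G : E n → Set (E n)) (z : E n) : Prop :=
  ∃ g ∈ G z, F z + g = 0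

/-- The symmetric part `(A + Aᵀ) / 2`. -/
def symPart (A : Matrix (Fin n) (Fin n) ℝ) : Matrix (Fin n) (Fin n) ℝ :=
  (1 / 2 : ℝ) • (A + A.transpose)

theorem symPart_isHermitian (A : Matrix (Fin n) (Fin n) ℝ) : (symPart A).IsHermitian := by
  ext i j
  simp [symPart, add_comm, mul_add]

/-- The margin `m = λ_min (sym (I - W))`. -/
def margin (W : Matrix (Fin n) (Fin n) ℝ) : ℝ :=
  ⨅ i, (symPart_isHermitian (1 - W)).eigenvalues i

/-- The Lipschitz constant `L = ‖I - W‖₂` (the norm is the spectral norm). -/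
def lipConst (W : Matrix (Fin n) (Fin n) ℝ) : ℝ := ‖1 - W‖

/-- The affine map `z ↦ (I - W) z - c`. -/
def affineOp (W : Matrix (Fin n) (Fin n) ℝ) (c : E n) (z : E n) : E n :=
  (1 - W).toEuclideanLin z - c

/-- `z` is a value at `y` of the resolvent `(I + α G)⁻¹`. -/
def IsResolventValue (α : ℝ) (G : E n → Set (E n)) (y z : E n) : Prop :=
  ∃ g ∈ G z, z + α • g = y

/-- The resolvent `(I + α G)⁻¹` is single-valued and defined on all of `ℝⁿ`. -/
def HasResolvent (α : ℝ) (G : E n → Set (E n)) : Prop :=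
  ∀ y, ∃! z, IsResolventValue α G y z

/-- The resolvent `J_{αG} = (I + α G)⁻¹` as a map (used for operators with `HasResolvent α G`;
an arbitrary choice elsewhere). -/
def res (α : ℝ) (G : E n → Set (E n)) (y : E n) : E n :=
  Classical.epsilon fun z => IsResolventValue α G y z

/-- The reflected resolvent `R_{αG} = 2 J_{αG} - I`. -/
def reflRes (α : ℝ) (G : E n → Set (E n)) (y : E n) : E n :=
  (2 : ℝ) • res α G y - y

/-- The forward-backward map `J_{αG} ∘ (I - α F)`. -/
def fbMap (α : ℝ) (F : E n → E n) (G : E n → Set (E n)) (z : E n) : E n :=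
  res α G (z - α • F z)

/-- The Peaceman-Rachford map `(2 J_{αG} - I) ∘ (2 J_{αF} - I)`. -/
def prMap (α : ℝ) (F : E n → E n) (G : E n → Set (E n)) (w : E n) : E n :=
  reflRes α G (reflRes α (single F) w)

/-- The forward-backward modulus `√(1 - 2 α m + α² L²)`. -/
def rFB (α m L : ℝ) : ℝ := √(1 - 2 * α * m + α ^ 2 * L ^ 2)

/-- The Peaceman-Rachford modulus `√(1 - 4 α m / (1 + α L)²)`. -/
def rhoPR (α m L : ℝ) : ℝ := √(1 - 4 * α * m / (1 + α * L) ^ 2)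

/-- `Φ` is a contraction of modulus `r < 1` with fixed point `z`, and its iterates converge to `z`
linearly with this modulus. -/
def ContractsTo (Φ : E n → E n) (r : ℝ) (z : E n) : Prop :=
  0 ≤ r ∧ r < 1 ∧ (∀ u v, ‖Φ u - Φ v‖ ≤ r * ‖u - v‖) ∧ Φ z = z ∧
    ∀ u, (∀ k : ℕ, ‖Φ^[k] u - z‖ ≤ r ^ k * ‖u - z‖) ∧ Tendsto (fun k => Φ^[k] u) atTop (𝓝 z)

/-- The splitting methods for `0 ∈ F(z) + G(z)` are well defined and converge to its unique
solution `z` with constants `(m, L)`: `F` is `m`-strongly monotone and `L`-Lipschitz, all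
resolvents involved exist, forward-backward splitting contracts to `z` with modulus `r_FB` for
every step `0 < α < 2m/L²`, and Peaceman-Rachford splitting contracts with modulus `ρ_PR` for every
`α > 0` to a point `w`, namely `w = z + α F(z)`, which `J_{αF}` maps to `z`. -/
structure SplittingConverges (F : E n → E n) (G : E n → Set (E n)) (m L : ℝ) (z : E n) :
    Prop where
  solves : SolvesInclusion F G z
  unique : ∀ z', SolvesInclusion F G z' → z' = z
  stronglyMonotone : ∀ u v, m * ‖u - v‖ ^ 2 ≤ inner ℝ (F u - F v) (u - v)
  lipschitz : ∀ u v, ‖F u - F v‖ ≤ L * ‖u - v‖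
  hasResolvent : ∀ α : ℝ, 0 < α → HasResolvent α G ∧ HasResolvent α (single F)
  forwardBackward : ∀ α : ℝ, 0 < α → α < 2 * m / L ^ 2 →
    ContractsTo (fbMap α F G) (rFB α m L) z
  peacemanRachford : ∀ α : ℝ, 0 < α →
    ContractsTo (prMap α F G) (rhoPR α m L) (z + α • F z) ∧
    res α (single F) (z + α • F z) = z ∧
    ∀ w, Tendsto (fun k => res α (single F) ((prMap α F G)^[k] w)) atTop (𝓝 z)

/-- Clarke's generalized Jacobian of `f` at `x`: the convex hull of all limits of derivatives
`f'(x_k)` along sequences `x_k → x` of points of differentiability (used for maps that are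
Lipschitz near `x`). -/
def clarkeJacobian (f : E n → E n) (x : E n) : Set (E n →L[ℝ] E n) :=
  convexHull ℝ {A | ∃ u : ℕ → E n, Tendsto u atTop (𝓝 x) ∧ (∀ k, DifferentiableAt ℝ f (u k)) ∧
    Tendsto (fun k => fderiv ℝ f (u k)) atTop (𝓝 A)}

/-- Near `z`, the set-valued operator `G` is the single-valued Lipschitz map `f`. -/
def IsLipschitzNear (G : E n → Set (E n)) (f : E n → E n) (z : E n) : Prop :=
  ∃ (K : NNReal) (N : Set (E n)), N ∈ 𝓝 z ∧ LipschitzOnWith K f N ∧ ∀ u ∈ N, G u = {f u}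

/-- `sym(A) ⪰ 0`, where `sym(A) = (A + Aᵀ) / 2`. -/
def SymNonneg (A : E n →L[ℝ] E n) : Prop :=
  ((1 / 2 : ℝ) • (A + ContinuousLinearMap.adjoint A)).IsPositive

/-- The set-valued linear operator `(D⁻¹ - I) / β`, i.e. the operator whose resolvent with
parameter `β` is `D`. It is the derivative of `G` when `D` is the derivative of `J_{βG}`. -/
def opOfResolvent (β : ℝ) (D : E n →L[ℝ] E n) : E n → Set (E n) :=
  fun p => {q | D (p + β • q) = p}

end MonDEQ

end

open Filter Topology
open scoped Matrix.Norms.L2Operator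

namespace MonDEQ

variable {n : ℕ}

/-! ### Resolvents -/

/-! Convergence of the splittings needs only a strongly monotone Lipschitz `F` and a monotone `T`
whose resolvents are everywhere defined. Such resolvents are firmly nonexpansive, so `J_{αT}` and
`2J_{αT} - I` are nonexpansive, while `I - αF` and `2J_{αF} - I` are strict contractions with the
stated moduli (`SplittingConverges.of_solves`). The forward pass then rests on Minty's theorem for
`G`, obtained here from a minimax theorem and compactness.

For the backward pass, `G` need not be differentiable at the equilibrium. Along the solution curve,
however, `G(z(t)) = -F_t(z(t))` is differentiable, and in the set-valued case so is `J_{βG}(z(t) -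
βF_t(z(t))) = z(t)`. Both cases follow from one chain rule: if a Lipschitz `f` has directional
derivative `v` at `x` along `p`, then `v = A p` for some `A` in the Clarke Jacobian. Otherwise a
functional `ℓ` separates `v` from the compact convex set of all `A p`; Rademacher's theorem and
Fubini give a mean value inequality for `ℓ ∘ f` that contradicts this.

Positivity `⟨Av, v⟩ ≥ 0` and firm nonexpansiveness `‖Dv‖² ≤ ⟨Dv, v⟩` are closed convex conditions,
so they pass from derivatives to every element of the Clarke Jacobian. They make the linearized
operators monotone with full resolvents, and the splitting result applies again. -/

theorem HasResolvent.res_spec {α : ℝ} {G : E n → Set (E n)} (h : HasResolvent α G) (y : E n) :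
    IsResolventValue α G y (res α G y) :=
  Classical.epsilon_spec (h y).exists

theorem HasResolvent.res_eq {α : ℝ} {G : E n → Set (E n)} (h : HasResolvent α G) {y z : E n}
    (hz : IsResolventValue α G y z) : res α G y = z :=
  (h y).unique (h.res_spec y) hz

/-- Resolvents of monotone operators are firmly nonexpansive. -/
theorem IsMonotoneOp.norm_sq_le_of_isResolventValue {α : ℝ} (hα : 0 < α) {G : E n → Set (E n)}
    (hG : IsMonotoneOp G) {y y' z z' : E n} (hz : IsResolventValue α G y z)
    (hz' : IsResolventValue α G y' z') :
    ‖z - z'‖ ^ 2 ≤ inner ℝ (z - z') (y - y') := by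
  obtain ⟨g, hg, rfl⟩ := hz
  obtain ⟨g', hg', rfl⟩ := hz'
  have h := hG z z' g hg g' hg'
  have e : z + α • g - (z' + α • g') = (z - z') + α • (g - g') := by module
  rw [e, inner_add_right, real_inner_self_eq_norm_sq, inner_smul_right, real_inner_comm]
  nlinarith [mul_nonneg hα.le h]

theorem IsMonotoneOp.isResolventValue_unique {α : ℝ} (hα : 0 < α) {G : E n → Set (E n)}
    (hG : IsMonotoneOp G) {y z z' : E n} (hz : IsResolventValue α G y z)
    (hz' : IsResolventValue α G y z') : z = z' := by
  have h := hG.norm_sq_le_of_isResolventValue hα hz hz'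
  rw [sub_self, inner_zero_right] at h
  rw [← sub_eq_zero, ← norm_eq_zero]
  exact pow_eq_zero_iff two_ne_zero |>.1 (le_antisymm h (sq_nonneg _))

theorem IsMonotoneOp.hasResolvent {α : ℝ} (hα : 0 < α) {G : E n → Set (E n)}
    (hG : IsMonotoneOp G) (h : ∀ y, ∃ z, IsResolventValue α G y z) : HasResolvent α G := by
  intro y
  obtain ⟨z, hz⟩ := h y
  exact ⟨z, hz, fun z' hz' => hG.isResolventValue_unique hα hz' hz⟩

theorem norm_sq_res_sub_le {α : ℝ} (hα : 0 < α) {G : E n → Set (E n)}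
    (hG : IsMonotoneOp G) (h : HasResolvent α G) (y y' : E n) :
    ‖res α G y - res α G y'‖ ^ 2 ≤ inner ℝ (res α G y - res α G y') (y - y') :=
  hG.norm_sq_le_of_isResolventValue hα (h.res_spec y) (h.res_spec y')

theorem norm_res_sub_le {α : ℝ} (hα : 0 < α) {G : E n → Set (E n)}
    (hG : IsMonotoneOp G) (h : HasResolvent α G) (y y' : E n) :
    ‖res α G y - res α G y'‖ ≤ ‖y - y'‖ := by
  have h1 := norm_sq_res_sub_le hα hG h y y'
  have h2 := real_inner_le_norm (res α G y - res α G y') (y - y')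
  by_contra! hc
  nlinarith [norm_nonneg (y - y'), norm_nonneg (res α G y - res α G y')]

/-- With `d` the difference of the resolvent values and `e = y - y'`, `‖2d - e‖² = ‖e‖² - 4(⟨d, e⟩ -
‖d‖²)`, and firm nonexpansiveness makes the bracket nonnegative. -/
theorem norm_reflRes_sub_le {α : ℝ} (hα : 0 < α) {G : E n → Set (E n)}
    (hG : IsMonotoneOp G) (h : HasResolvent α G) (y y' : E n) :
    ‖reflRes α G y - reflRes α G y'‖ ≤ ‖y - y'‖ := by
  have h1 := norm_sq_res_sub_le hα hG h y y'
  have e : reflRes α G y - reflRes α G y' = (2 : ℝ) • (res α G y - res α G y') - (y - y') := by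
    simp only [reflRes]; module
  refine (le_abs_self _).trans (abs_le_of_sq_le_sq ?_ (norm_nonneg _))
  rw [e, norm_sub_sq_real, norm_smul, inner_smul_left]
  simp only [Real.norm_ofNat, conj_trivial]
  nlinarith

/-! ### Convergence of the splitting methods -/

theorem ContractsTo.of_lipschitz {Φ : E n → E n} {r : ℝ} {z : E n} (h0 : 0 ≤ r) (h1 : r < 1)
    (hΦ : ∀ u v, ‖Φ u - Φ v‖ ≤ r * ‖u - v‖) (hz : Φ z = z) : ContractsTo Φ r z := by
  refine ⟨h0, h1, hΦ, hz, fun u => ?_⟩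
  have hk : ∀ k : ℕ, ‖Φ^[k] u - z‖ ≤ r ^ k * ‖u - z‖ := by
    intro k
    induction k with
    | zero => simp
    | succ k ih =>
      rw [Function.iterate_succ_apply']
      calc ‖Φ (Φ^[k] u) - z‖ = ‖Φ (Φ^[k] u) - Φ z‖ := by rw [hz]
        _ ≤ r * ‖Φ^[k] u - z‖ := hΦ _ _
        _ ≤ r * (r ^ k * ‖u - z‖) := by gcongr
        _ = r ^ (k + 1) * ‖u - z‖ := by ring
  refine ⟨hk, tendsto_iff_norm_sub_tendsto_zero.2 ?_⟩
  refine squeeze_zero (fun _ => norm_nonneg _) hk ?_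
  simpa using (tendsto_pow_atTop_nhds_zero_of_lt_one h0 h1).mul_const ‖u - z‖

/-- The sign of `c` is left open, so the moduli can be used without checking that their radicands
are nonnegative. -/
theorem norm_le_sqrt_mul {a b c : ℝ} (hb : 0 ≤ b) (h : a ^ 2 ≤ c * b ^ 2) : a ≤ √c * b := by
  refine (le_abs_self _).trans (abs_le_of_sq_le_sq (h.trans ?_) (by positivity))
  rw [mul_pow]
  gcongr
  rcases le_total 0 c with hc | hc
  · rw [Real.sq_sqrt hc]
  · exact hc.trans (sq_nonneg _)

theorem isMonotoneOp_single_of_stronglyMonotone {F : E n → E n} {m : ℝ} (hm : 0 ≤ m)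
    (hF : ∀ u v, m * ‖u - v‖ ^ 2 ≤ inner ℝ (F u - F v) (u - v)) : IsMonotoneOp (single F) := by
  rintro x y _ rfl _ rfl
  exact le_trans (by positivity) (hF x y)

theorem norm_fbMap_sub_le {α m L : ℝ} (hα : 0 < α) {F : E n → E n} {T : E n → Set (E n)}
    (hF : ∀ u v, m * ‖u - v‖ ^ 2 ≤ inner ℝ (F u - F v) (u - v))
    (hL : ∀ u v, ‖F u - F v‖ ≤ L * ‖u - v‖)
    (hT : IsMonotoneOp T) (hres : HasResolvent α T) (u v : E n) :
    ‖fbMap α F T u - fbMap α F T v‖ ≤ rFB α m L * ‖u - v‖ := by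
  refine (norm_res_sub_le hα hT hres _ _).trans (norm_le_sqrt_mul (norm_nonneg _) ?_)
  have e : u - α • F u - (v - α • F v) = (u - v) - α • (F u - F v) := by module
  have h1 : ‖F u - F v‖ ^ 2 ≤ (L * ‖u - v‖) ^ 2 := by gcongr; exact hL u v
  rw [e, norm_sub_sq_real, norm_smul, inner_smul_right, real_inner_comm, mul_pow, Real.norm_eq_abs,
    sq_abs]
  nlinarith [mul_le_mul_of_nonneg_left (hF u v) hα.le,
    mul_le_mul_of_nonneg_left h1 (sq_nonneg α)]

theorem fbMap_eq_self_iff {α : ℝ} (hα : 0 < α) {F : E n → E n} {T : E n → Set (E n)}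
    (hres : HasResolvent α T) (z : E n) : fbMap α F T z = z ↔ SolvesInclusion F T z := by
  constructor
  · intro h
    obtain ⟨g, hg, e⟩ := hres.res_spec (z - α • F z)
    change res α T (z - α • F z) = z at h
    rw [h] at hg e
    refine ⟨g, hg, ?_⟩
    have : α • (F z + g) = 0 := by
      calc α • (F z + g) = (z + α • g) - (z - α • F z) := by module
        _ = 0 := by rw [e, sub_self]
    exact (smul_eq_zero.1 this).resolve_left hα.ne'
  · rintro ⟨g, hg, e⟩
    refine hres.res_eq ⟨g, hg, ?_⟩
    rw [eq_neg_of_add_eq_zero_right e]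
    module

/-- With `d = u - v` for the resolvent values and `e = F u - F v`, the inputs differ by `d + αe` and
the outputs by `d - αe`. The squared norms differ by `4α⟨e, d⟩ ≥ 4αm‖d‖²`, and `‖d‖ ≥ ‖y - y'‖ / (1
+ αL)`. -/
theorem norm_reflRes_single_sub_le {α m L : ℝ} (hα : 0 < α) (hm : 0 < m) (hL0 : 0 < L)
    {F : E n → E n}
    (hF : ∀ u v, m * ‖u - v‖ ^ 2 ≤ inner ℝ (F u - F v) (u - v))
    (hL : ∀ u v, ‖F u - F v‖ ≤ L * ‖u - v‖)
    (hres : HasResolvent α (single F)) (y y' : E n) :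
    ‖reflRes α (single F) y - reflRes α (single F) y'‖ ≤ rhoPR α m L * ‖y - y'‖ := by
  obtain ⟨_, rfl, e⟩ := hres.res_spec y
  obtain ⟨_, rfl, e'⟩ := hres.res_spec y'
  simp only [reflRes]
  set u := res α (single F) y
  set v := res α (single F) y'
  refine norm_le_sqrt_mul (norm_nonneg _) ?_
  have e1 : y - y' = (u - v) + α • (F u - F v) := by rw [← e, ← e']; module
  have e2 : (2 : ℝ) • u - y - ((2 : ℝ) • v - y') = (u - v) - α • (F u - F v) := by
    rw [← e, ← e']; module
  have h1 : ‖y - y'‖ ≤ (1 + α * L) * ‖u - v‖ := by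
    rw [e1]
    refine (norm_add_le _ _).trans ?_
    rw [norm_smul, Real.norm_eq_abs, abs_of_pos hα]
    nlinarith [mul_le_mul_of_nonneg_left (hL u v) hα.le]
  have h2 : ‖y - y'‖ ^ 2 / (1 + α * L) ^ 2 ≤ ‖u - v‖ ^ 2 := by
    rw [div_le_iff₀ (by positivity)]
    calc _ ≤ ((1 + α * L) * ‖u - v‖) ^ 2 := by gcongr
      _ = _ := by ring
  have h3 : ‖(u - v) - α • (F u - F v)‖ ^ 2 =
      ‖y - y'‖ ^ 2 - 4 * α * inner ℝ (F u - F v) (u - v) := by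
    rw [e1, norm_sub_sq_real, norm_add_sq_real, inner_smul_right, real_inner_comm]
    ring
  rw [e2, h3]
  have h4 := mul_le_mul_of_nonneg_left (hF u v) (by positivity : 0 ≤ 4 * α)
  have h5 := mul_le_mul_of_nonneg_left h2 (by positivity : 0 ≤ 4 * α * m)
  have e3 : (1 - 4 * α * m / (1 + α * L) ^ 2) * ‖y - y'‖ ^ 2 =
      ‖y - y'‖ ^ 2 - 4 * α * m * (‖y - y'‖ ^ 2 / (1 + α * L) ^ 2) := by ring
  rw [e3]
  linarith

theorem rFB_lt_one {α m L : ℝ} (hα : 0 < α) (hL0 : 0 < L) (h : α < 2 * m / L ^ 2) :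
    rFB α m L < 1 := by
  rw [rFB, Real.sqrt_lt' one_pos]
  rw [lt_div_iff₀ (by positivity)] at h
  nlinarith [mul_lt_mul_of_pos_left h hα]

theorem rhoPR_lt_one {α m L : ℝ} (hα : 0 < α) (hm : 0 < m) (hL0 : 0 < L) : rhoPR α m L < 1 := by
  rw [rhoPR, Real.sqrt_lt' one_pos]
  have : 0 < 4 * α * m / (1 + α * L) ^ 2 := by positivity
  linarith

theorem SplittingConverges.of_solves {F : E n → E n} {T : E n → Set (E n)} {m L : ℝ} {z : E n}
    (hm : 0 < m) (hL0 : 0 < L)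
    (hF : ∀ u v, m * ‖u - v‖ ^ 2 ≤ inner ℝ (F u - F v) (u - v))
    (hL : ∀ u v, ‖F u - F v‖ ≤ L * ‖u - v‖) (hT : IsMonotoneOp T)
    (hresF : ∀ α : ℝ, 0 < α → HasResolvent α (single F))
    (hresT : ∀ α : ℝ, 0 < α → HasResolvent α T) (hz : SolvesInclusion F T z) :
    SplittingConverges F T m L z := by
  have hresz : ∀ α : ℝ, 0 < α → res α (single F) (z + α • F z) = z :=
    fun α hα => (hresF α hα).res_eq ⟨_, rfl, rfl⟩
  have hPR : ∀ α : ℝ, 0 < α → ContractsTo (prMap α F T) (rhoPR α m L) (z + α • F z) := by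
    intro α hα
    refine .of_lipschitz (Real.sqrt_nonneg _) (rhoPR_lt_one hα hm hL0) (fun u v => ?_) ?_
    · exact (norm_reflRes_sub_le hα hT (hresT α hα) _ _).trans
        (norm_reflRes_single_sub_le hα hm hL0 hF hL (hresF α hα) u v)
    · obtain ⟨g, hg, e⟩ := hz
      have e1 : reflRes α (single F) (z + α • F z) = z - α • F z := by
        rw [reflRes, hresz α hα]; module
      have e2 : res α T (z - α • F z) = z :=
        (hresT α hα).res_eq ⟨g, hg, by rw [eq_neg_of_add_eq_zero_right e]; module⟩
      rw [prMap, e1, reflRes, e2]; module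
  refine ⟨hz, fun z' hz' => ?_, hF, hL, fun α hα => ⟨hresT α hα, hresF α hα⟩, ?_, ?_⟩
  · obtain ⟨g, hg, e⟩ := hz
    obtain ⟨g', hg', e'⟩ := hz'
    have h1 := hT z' z g' hg' g hg
    have h2 := hF z' z
    rw [eq_neg_of_add_eq_zero_left e, eq_neg_of_add_eq_zero_left e'] at h2
    have e3 : -g' - -g = -(g' - g) := by abel
    rw [e3, inner_neg_left] at h2
    have h3 : ‖z' - z‖ ^ 2 = 0 := by nlinarith [sq_nonneg ‖z' - z‖]
    rwa [pow_eq_zero_iff two_ne_zero, norm_eq_zero, sub_eq_zero] at h3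
  · intro α hα h
    exact .of_lipschitz (Real.sqrt_nonneg _) (rFB_lt_one hα hL0 h)
      (norm_fbMap_sub_le hα hF hL hT (hresT α hα)) ((fbMap_eq_self_iff hα (hresT α hα) z).2 hz)
  · intro α hα
    refine ⟨hPR α hα, hresz α hα, fun w => ?_⟩
    have hFm := isMonotoneOp_single_of_stronglyMonotone hm.le hF
    have hl : LipschitzWith 1 (res α (single F)) := LipschitzWith.of_dist_le_mul fun y y' => by
      simpa [dist_eq_norm] using norm_res_sub_le hα hFm (hresF α hα) y y'
    have := (hl.continuous.tendsto _).comp ((hPR α hα).2.2.2.2 w).2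
    rwa [hresz α hα] at this

/-- A strongly monotone Lipschitz inclusion has a solution, by Banach's fixed point theorem for
the forward-backward map. -/
theorem exists_solvesInclusion {F : E n → E n} {T : E n → Set (E n)} {m L : ℝ}
    (hm : 0 < m) (hL0 : 0 < L)
    (hF : ∀ u v, m * ‖u - v‖ ^ 2 ≤ inner ℝ (F u - F v) (u - v))
    (hL : ∀ u v, ‖F u - F v‖ ≤ L * ‖u - v‖) (hT : IsMonotoneOp T)
    (hresT : ∀ α : ℝ, 0 < α → HasResolvent α T) : ∃ z, SolvesInclusion F T z := by
  -- The step `m / L²` is the midpoint of the admissible interval and minimizes the radicand of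
  -- `rFB`.
  have hα : 0 < m / L ^ 2 := by positivity
  have h1 : rFB (m / L ^ 2) m L < 1 := by
    refine rFB_lt_one hα hL0 ?_
    gcongr
    linarith
  have hc : ContractingWith ⟨rFB (m / L ^ 2) m L, Real.sqrt_nonneg _⟩ (fbMap (m / L ^ 2) F T) :=
    ⟨by exact_mod_cast h1, LipschitzWith.of_dist_le_mul fun u v => by
      simpa only [dist_eq_norm] using! norm_fbMap_sub_le hα hF hL hT (hresT _ hα) u v⟩
  exact ⟨_, (fbMap_eq_self_iff hα (hresT _ hα) _).1 hc.fixedPoint_isFixedPt⟩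

theorem exists_splittingConverges {F : E n → E n} {T : E n → Set (E n)} {m L : ℝ}
    (hm : 0 < m) (hL0 : 0 < L)
    (hF : ∀ u v, m * ‖u - v‖ ^ 2 ≤ inner ℝ (F u - F v) (u - v))
    (hL : ∀ u v, ‖F u - F v‖ ≤ L * ‖u - v‖) (hT : IsMonotoneOp T)
    (hresF : ∀ α : ℝ, 0 < α → HasResolvent α (single F))
    (hresT : ∀ α : ℝ, 0 < α → HasResolvent α T) : ∃ z, SplittingConverges F T m L z :=
  (exists_solvesInclusion hm hL0 hF hL hT hresT).imp fun _ hz =>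
    .of_solves hm hL0 hF hL hT hresF hresT hz

/-! ### Minty's theorem -/

/-- The finite case of Minty's theorem, a consequence of the minimax theorem. -/
theorem exists_forall_inner_le_zero {ι : Type*} [Finite ι] [Nonempty ι] {α : ℝ} (hα : 0 < α)
    (x u : ι → E n) (hmon : ∀ i j, 0 ≤ inner ℝ (u i - u j) (x i - x j)) (y : E n) :
    ∃ z, ∀ i, inner ℝ (z - y + α • u i) (z - x i) ≤ 0 := by
  classical
  have := Fintype.ofFinite ι
  -- The constraints averaged with weights `l`: convex in `z`, linear in `l`. At a saddle point `(z,
  -- l)` each constraint value at `z` is at most `φ w l`, for any `w` in the hull.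
  let φ : E n → (ι → ℝ) → ℝ := fun z l => ∑ i, l i * inner ℝ (z - y + α • u i) (z - x i)
  have hconv : ∀ i, ConvexOn ℝ Set.univ fun z : E n => inner ℝ (z - y + α • u i) (z - x i) := by
    intro i
    refine ⟨convex_univ, fun a _ b _ s t hs ht hst => ?_⟩
    have key : s • inner ℝ (a - y + α • u i) (a - x i) + t • inner ℝ (b - y + α • u i) (b - x i)
        - inner ℝ ((s • a + t • b) - y + α • u i) ((s • a + t • b) - x i)
        = s * t * ‖a - b‖ ^ 2 := by
      obtain rfl : t = 1 - s := by linarith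
      rw [← real_inner_self_eq_norm_sq]
      simp only [inner_add_left, inner_sub_left, inner_add_right, inner_sub_right, inner_smul_left,
        inner_smul_right, smul_eq_mul, conj_trivial, real_inner_comm a b]
      ring
    have : 0 ≤ s * t * ‖a - b‖ ^ 2 := by positivity
    linarith
  obtain ⟨z, -, l, hl, hs⟩ := Sion.exists_isSaddlePointOn (X := convexHull ℝ (Set.range x))
    (Y := stdSimplex ℝ ι) (f := φ) (Set.range_nonempty x).convexHull (convex_convexHull ℝ _)
    ((Set.finite_range x).isCompact_convexHull ℝ)
    (fun l _ => Continuous.lowerSemicontinuous (by fun_prop) |>.lowerSemicontinuousOn _)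
    (fun l hl => (ConvexOn.quasiconvexOn (by
      refine ⟨convex_convexHull ℝ _, fun a _ b _ s t hs ht hst => ?_⟩
      simp only [φ, smul_eq_mul, Finset.mul_sum, ← Finset.sum_add_distrib]
      refine Finset.sum_le_sum fun i _ => ?_
      have h := (hconv i).2 (Set.mem_univ a) (Set.mem_univ b) hs ht hst
      have := mul_le_mul_of_nonneg_left h (hl.1 i)
      simp only [smul_eq_mul] at this
      linarith)))
    (convex_stdSimplex ℝ ι) ⟨_, single_mem_stdSimplex ℝ (Classical.arbitrary ι)⟩ (isCompact_stdSimplex ℝ ι)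
    (fun z _ => Continuous.upperSemicontinuous (by fun_prop) |>.upperSemicontinuousOn _)
    (fun z _ => (ConcaveOn.quasiconcaveOn (by
      refine ⟨convex_stdSimplex ℝ ι, fun a _ b _ s t hs ht hst => le_of_eq ?_⟩
      simp only [φ, smul_eq_mul, Finset.mul_sum, ← Finset.sum_add_distrib, Pi.add_apply,
        Pi.smul_apply]
      exact Finset.sum_congr rfl fun i _ => by ring)))
  refine ⟨z, fun i => ?_⟩
  have h := hs (∑ j, l j • x j) ((convex_convexHull ℝ _).sum_mem (fun j _ => hl.1 j) hl.2
    fun j _ => subset_convexHull ℝ _ ⟨j, rfl⟩) (Pi.single i 1) (single_mem_stdSimplex ℝ i)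
  have e1 : φ z (Pi.single i 1) = inner ℝ (z - y + α • u i) (z - x i) := by
    simp [φ, Pi.single_apply]
  rw [e1] at h
  refine h.trans ?_
  -- Testing against the barycentre `w` removes the terms in `w - y`; the rest, symmetrized in `i`
  -- and `j`, is nonpositive by monotonicity.
  set w := ∑ j, l j • x j with hw
  have e2 : φ w l = α * ∑ i, l i * inner ℝ (u i) (w - x i) := by
    have : ∑ i, l i * inner ℝ (w - y) (w - x i) = 0 := by
      have : ∑ i, l i • (w - x i) = 0 := by
        simp only [smul_sub, Finset.sum_sub_distrib, ← Finset.sum_smul, hl.2, one_smul, ← hw,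
          sub_self]
      simp only [← inner_smul_right, ← inner_sum, this, inner_zero_right]
    simp only [φ, inner_add_left, mul_add, Finset.sum_add_distrib, this, zero_add, Finset.mul_sum,
      inner_smul_left, conj_trivial]
    exact Finset.sum_congr rfl fun i _ => by ring
  have e3 : ∑ i, l i * inner ℝ (u i) (w - x i) =
      ∑ i, ∑ j, l i * l j * inner ℝ (u i) (x j - x i) := by
    refine Finset.sum_congr rfl fun i _ => ?_
    have : w - x i = ∑ j, l j • (x j - x i) := by
      simp only [smul_sub, Finset.sum_sub_distrib, ← Finset.sum_smul, hl.2, one_smul, ← hw]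
    rw [this, inner_sum, Finset.mul_sum]
    exact Finset.sum_congr rfl fun j _ => by rw [inner_smul_right]; ring
  have e4 : ∑ i, ∑ j, l i * l j * inner ℝ (u i) (x j - x i) =
      ∑ i, ∑ j, l i * l j * inner ℝ (u j) (x i - x j) := by
    rw [Finset.sum_comm]
    exact Finset.sum_congr rfl fun i _ => Finset.sum_congr rfl fun j _ => by ring
  have e5 : ∑ i, ∑ j, l i * l j * inner ℝ (u i) (x j - x i) ≤ 0 := by
    have : ∑ i, ∑ j, l i * l j * inner ℝ (u i) (x j - x i) +
        ∑ i, ∑ j, l i * l j * inner ℝ (u j) (x i - x j) ≤ 0 := by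
      simp only [← Finset.sum_add_distrib]
      refine Finset.sum_nonpos fun i _ => Finset.sum_nonpos fun j _ => ?_
      have h1 := mul_nonneg (mul_nonneg (hl.1 i) (hl.1 j)) (hmon i j)
      have e : inner ℝ (u i) (x j - x i) + inner ℝ (u j) (x i - x j)
          = - inner ℝ (u i - u j) (x i - x j) := by
        simp only [inner_sub_left, inner_sub_right]; ring
      rw [← mul_add, e]
      linarith
    linarith
  rw [e2, e3]
  exact mul_nonpos_of_nonneg_of_nonpos hα.le e5

/-- **Minty's theorem**: every maximal monotone operator on `ℝⁿ` has resolvents that are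
single-valued and everywhere defined. -/
theorem IsMaximalMonotoneOp.hasResolvent {G : E n → Set (E n)} (hG : IsMaximalMonotoneOp G)
    {α : ℝ} (hα : 0 < α) : HasResolvent α G := by
  refine hG.1.hasResolvent hα fun y => ?_
  let Γ := {q : E n × E n // q.2 ∈ G q.1}
  -- A common point `z` of all `C q` makes `(z, α⁻¹(y - z))` monotonically related to the whole
  -- graph. Each `C q` is compact, so finite intersections suffice.
  let C : Γ → Set (E n) := fun q => {z | inner ℝ (z - y + α • q.1.2) (z - q.1.1) ≤ 0}
  have hC : ∀ q, IsClosed (C q) := fun q => isClosed_le (by fun_prop) (by fun_prop)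
  have hCb : ∀ q, IsCompact (C q) := by
    intro q
    refine Metric.isCompact_of_isClosed_isBounded (hC q) ?_
    refine (Metric.isBounded_closedBall (x := q.1.1) (r := ‖q.1.1 - y + α • q.1.2‖)).subset ?_
    intro z hz
    change inner ℝ (z - y + α • q.1.2) (z - q.1.1) ≤ 0 at hz
    have e : z - y + α • q.1.2 = (z - q.1.1) + (q.1.1 - y + α • q.1.2) := by abel
    rw [e, inner_add_left, real_inner_self_eq_norm_sq] at hz
    have h1 := neg_le_of_abs_le (abs_real_inner_le_norm (q.1.1 - y + α • q.1.2) (z - q.1.1))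
    rw [mem_closedBall_iff_norm]
    by_contra! hc
    nlinarith [norm_nonneg (z - q.1.1), norm_nonneg (q.1.1 - y + α • q.1.2)]
  have hne : (⋂ q, C q).Nonempty := by
    rcases isEmpty_or_nonempty Γ with h0 | ⟨⟨q₀⟩⟩
    · exact ⟨y, Set.mem_iInter.2 fun q => h0.elim q⟩
    · have := (hCb q₀).inter_iInter_nonempty C hC fun s => by
        classical
        have : Nonempty {q // q ∈ insert q₀ s} := ⟨q₀, by simp⟩
        obtain ⟨z, hz⟩ := exists_forall_inner_le_zero (ι := {q // q ∈ insert q₀ s}) hα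
          (fun q => q.1.1.1) (fun q => q.1.1.2)
          (fun i j => hG.1 _ _ _ i.1.2 _ j.1.2) y
        refine ⟨z, hz ⟨q₀, by simp⟩, ?_⟩
        simp only [Set.mem_iInter]
        exact fun q hq => hz ⟨q, by simp [hq]⟩
      exact this.mono Set.inter_subset_right
  obtain ⟨z, hz⟩ := hne
  rw [Set.mem_iInter] at hz
  set v : E n := α⁻¹ • (y - z) with hv
  have hv' : α • v = y - z := by rw [hv, smul_inv_smul₀ hα.ne']
  have hmon : ∀ x, ∀ u ∈ G x, 0 ≤ inner ℝ (v - u) (z - x) := by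
    intro x u hu
    have h1 : inner ℝ (z - y + α • u) (z - x) ≤ 0 := hz ⟨(x, u), hu⟩
    have e : z - y + α • u = -(α • (v - u)) := by rw [smul_sub, hv']; abel
    rw [e, inner_neg_left, inner_smul_left, conj_trivial, neg_nonpos] at h1
    exact nonneg_of_mul_nonneg_right h1 hα
  -- Adjoining `(z, v)` to the graph keeps it monotone, so maximality puts `v` in `G z`.
  have hmax := hG.2 (fun x => G x ∪ {u | x = z ∧ u = v}) (by
    rintro a b u (hu | ⟨rfl, rfl⟩) w (hw | ⟨rfl, rfl⟩)
    · exact hG.1 _ _ _ hu _ hw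
    · rw [← inner_neg_neg, neg_sub, neg_sub]; exact hmon _ _ hu
    · exact hmon _ _ hw
    · simp) fun x => Set.subset_union_left
  have hmem : v ∈ G z := by rw [← hmax]; exact Or.inr ⟨rfl, rfl⟩
  exact ⟨z, v, hmem, by rw [hv']; abel⟩

/-! ### The margin and the Lipschitz constant -/

theorem inner_toEuclideanLin_symPart (A : Matrix (Fin n) (Fin n) ℝ) (v : E n) :
    inner ℝ ((symPart A).toEuclideanLin v) v = inner ℝ (A.toEuclideanLin v) v := by
  have h : inner ℝ (A.transpose.toEuclideanLin v) v = inner ℝ (A.toEuclideanLin v) v := by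
    rw [← Matrix.conjTranspose_eq_transpose_of_trivial,
      Matrix.toEuclideanLin_conjTranspose_eq_adjoint, LinearMap.adjoint_inner_left,
      real_inner_comm]
  rw [symPart, map_smul, map_add, LinearMap.smul_apply, LinearMap.add_apply, inner_smul_left,
    inner_add_left, h, conj_trivial]
  ring

theorem _root_.Matrix.IsHermitian.toEuclideanLin_eigenvectorBasis
    {A : Matrix (Fin n) (Fin n) ℝ} (hA : A.IsHermitian) (i : Fin n) :
    A.toEuclideanLin (hA.eigenvectorBasis i) = hA.eigenvalues i • hA.eigenvectorBasis i := by
  have h := hA.mulVec_eigenvectorBasis i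
  ext j
  simpa using congrFun h j

theorem _root_.Matrix.IsHermitian.iInf_eigenvalues_mul_le
    {A : Matrix (Fin n) (Fin n) ℝ} (hA : A.IsHermitian) (v : E n) :
    (⨅ i, hA.eigenvalues i) * ‖v‖ ^ 2 ≤ inner ℝ (A.toEuclideanLin v) v := by
  rw [← hA.eigenvectorBasis.sum_inner_mul_inner, ← real_inner_self_eq_norm_sq,
    ← hA.eigenvectorBasis.sum_inner_mul_inner v v, Finset.mul_sum]
  refine Finset.sum_le_sum fun i _ => ?_
  have hs := Matrix.isSymmetric_toEuclideanLin_iff.2 hA v (hA.eigenvectorBasis i)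
  rw [hs, hA.toEuclideanLin_eigenvectorBasis, inner_smul_right, mul_assoc]
  refine mul_le_mul_of_nonneg_right (ciInf_le (Set.finite_range _).bddBelow i) ?_
  rw [real_inner_comm]
  exact mul_self_nonneg _

theorem margin_mul_norm_sq_le (W : Matrix (Fin n) (Fin n) ℝ) (v : E n) :
    margin W * ‖v‖ ^ 2 ≤ inner ℝ ((1 - W).toEuclideanLin v) v := by
  rw [← inner_toEuclideanLin_symPart]
  exact (symPart_isHermitian (1 - W)).iInf_eigenvalues_mul_le v

theorem exists_inner_eq_margin [Nonempty (Fin n)] (W : Matrix (Fin n) (Fin n) ℝ) :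
    ∃ v : E n, ‖v‖ = 1 ∧ inner ℝ ((1 - W).toEuclideanLin v) v = margin W := by
  obtain ⟨i, hi⟩ := exists_eq_ciInf_of_finite
    (f := (symPart_isHermitian (1 - W)).eigenvalues)
  refine ⟨(symPart_isHermitian (1 - W)).eigenvectorBasis i,
    (symPart_isHermitian (1 - W)).eigenvectorBasis.orthonormal.1 i, ?_⟩
  rw [← inner_toEuclideanLin_symPart, Matrix.IsHermitian.toEuclideanLin_eigenvectorBasis,
    inner_smul_left, real_inner_self_eq_norm_sq,
    (symPart_isHermitian (1 - W)).eigenvectorBasis.orthonormal.1 i, hi, margin]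
  simp

theorem norm_toEuclideanLin_le (A : Matrix (Fin n) (Fin n) ℝ) (v : E n) :
    ‖A.toEuclideanLin v‖ ≤ ‖A‖ * ‖v‖ :=
  A.l2_opNorm_mulVec v

theorem margin_sub_norm_le (W V : Matrix (Fin n) (Fin n) ℝ) :
    margin W - ‖V‖ ≤ margin (W + V) := by
  rcases isEmpty_or_nonempty (Fin n) with h0 | h0
  -- In dimension `0` the infimum over no eigenvalues is `0`, and the claim is `-‖V‖ ≤ 0`.
  · simp [margin, Real.iInf_of_isEmpty]
  · obtain ⟨v, hv, e⟩ := exists_inner_eq_margin (W + V)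
    have h1 := margin_mul_norm_sq_le W v
    have h2 := (le_abs_self _).trans (abs_real_inner_le_norm (V.toEuclideanLin v) v)
    have h3 := norm_toEuclideanLin_le V v
    rw [← sub_sub, map_sub, LinearMap.sub_apply, inner_sub_left] at e
    rw [hv] at h1 h2 h3
    linarith

theorem abs_lipConst_sub_norm_le (W V : Matrix (Fin n) (Fin n) ℝ) :
    |lipConst W - ‖V‖| ≤ lipConst (W + V) := by
  rw [lipConst, lipConst, ← sub_sub]
  exact abs_norm_sub_norm_le _ _

theorem lipConst_add_le (W V : Matrix (Fin n) (Fin n) ℝ) :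
    lipConst (W + V) ≤ lipConst W + ‖V‖ := by
  rw [lipConst, lipConst, ← sub_sub]
  exact norm_sub_le _ _

theorem lipConst_pos {W : Matrix (Fin n) (Fin n) ℝ} (h : 0 < margin W) : 0 < lipConst W := by
  rcases isEmpty_or_nonempty (Fin n) with h0 | h0
  · simp [margin, Real.iInf_of_isEmpty] at h
  · obtain ⟨v, hv, e⟩ := exists_inner_eq_margin W
    have h2 := (le_abs_self _).trans (abs_real_inner_le_norm ((1 - W).toEuclideanLin v) v)
    have h3 := norm_toEuclideanLin_le (1 - W) v
    rw [hv] at h2 h3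
    rw [lipConst]
    linarith

/-! ### Affine operators -/

theorem affineOp_sub_affineOp (W : Matrix (Fin n) (Fin n) ℝ) (c u v : E n) :
    affineOp W c u - affineOp W c v = (1 - W).toEuclideanLin (u - v) := by
  rw [affineOp, affineOp, map_sub (Matrix.toEuclideanLin (1 - W)) u v]
  abel

theorem affineOp_stronglyMonotone (W : Matrix (Fin n) (Fin n) ℝ) (c u v : E n) :
    margin W * ‖u - v‖ ^ 2 ≤ inner ℝ (affineOp W c u - affineOp W c v) (u - v) := by
  rw [affineOp_sub_affineOp]
  exact margin_mul_norm_sq_le W _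

theorem norm_affineOp_sub_le (W : Matrix (Fin n) (Fin n) ℝ) (c u v : E n) :
    ‖affineOp W c u - affineOp W c v‖ ≤ lipConst W * ‖u - v‖ := by
  rw [affineOp_sub_affineOp]
  exact norm_toEuclideanLin_le _ _

/-- Positivity of `B` makes `I + αB` injective, hence surjective in finite dimension. -/
theorem hasResolvent_single_of_linear {B : E n →ₗ[ℝ] E n} (hB : ∀ v, 0 ≤ inner ℝ (B v) v) (c : E n)
    {α : ℝ} (hα : 0 < α) : HasResolvent α (single fun z => B z - c) := by
  refine IsMonotoneOp.hasResolvent hα ?_ fun y => ?_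
  · rintro x y _ rfl _ rfl
    rw [sub_sub_sub_cancel_right, ← map_sub]
    exact hB _
  · have hinj : Function.Injective (LinearMap.id + α • B : E n →ₗ[ℝ] E n) := by
      rw [← LinearMap.ker_eq_bot, LinearMap.ker_eq_bot']
      intro v hv
      have h : inner ℝ (v + α • B v) v = 0 := by
        have : v + α • B v = 0 := hv
        rw [this, inner_zero_left]
      rw [inner_add_left, inner_smul_left, real_inner_self_eq_norm_sq, conj_trivial] at h
      have := mul_nonneg hα.le (hB v)
      have h2 : ‖v‖ ^ 2 = 0 := by nlinarith [sq_nonneg ‖v‖]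
      simpa using h2
    obtain ⟨z, hz⟩ := LinearMap.injective_iff_surjective.1 hinj (y + α • c)
    refine ⟨z, _, rfl, ?_⟩
    change z + α • B z = _ at hz
    rw [smul_sub, ← add_sub_assoc, hz, add_sub_cancel_right]

theorem hasResolvent_affineOp {W : Matrix (Fin n) (Fin n) ℝ} (hW : 0 ≤ margin W) (c : E n)
    {α : ℝ} (hα : 0 < α) : HasResolvent α (single (affineOp W c)) :=
  hasResolvent_single_of_linear
    (fun v => le_trans (by positivity) (margin_mul_norm_sq_le W v)) c hα

theorem splittingConverges_affineOp {W : Matrix (Fin n) (Fin n) ℝ} (hW : 0 < margin W) {c z : E n}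
    {T : E n → Set (E n)} (hT : IsMonotoneOp T) (hres : ∀ α : ℝ, 0 < α → HasResolvent α T)
    (hz : SolvesInclusion (affineOp W c) T z) :
    SplittingConverges (affineOp W c) T (margin W) (lipConst W) z :=
  .of_solves hW (lipConst_pos hW) (affineOp_stronglyMonotone W c) (norm_affineOp_sub_le W c) hT
    (fun _ => hasResolvent_affineOp hW.le c) hres hz

theorem exists_splittingConverges_affineOp {W : Matrix (Fin n) (Fin n) ℝ} (hW : 0 < margin W)
    (c : E n) {T : E n → Set (E n)} (hT : IsMonotoneOp T)
    (hres : ∀ α : ℝ, 0 < α → HasResolvent α T) :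
    ∃ z, SplittingConverges (affineOp W c) T (margin W) (lipConst W) z :=
  exists_splittingConverges hW (lipConst_pos hW) (affineOp_stronglyMonotone W c)
    (norm_affineOp_sub_le W c) hT (fun _ => hasResolvent_affineOp hW.le c) hres

theorem hasDerivAt_toEuclideanLin {m k : ℕ} {A : ℝ → Matrix (Fin m) (Fin k) ℝ}
    {A' : Matrix (Fin m) (Fin k) ℝ} {z : ℝ → E k} {z' : E k} {t : ℝ} (hA : HasDerivAt A A' t)
    (hz : HasDerivAt z z' t) :
    HasDerivAt (fun s => (A s).toEuclideanLin (z s))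
      (A'.toEuclideanLin (z t) + (A t).toEuclideanLin z') t := by
  let Λ : Matrix (Fin m) (Fin k) ℝ →L[ℝ] (E k →L[ℝ] E m) := LinearMap.toContinuousLinearMap
    (Matrix.toEuclideanLin.trans LinearMap.toContinuousLinearMap).toLinearMap
  exact (Λ.hasFDerivAt.comp_hasDerivAt t hA).clm_apply hz

theorem hasDerivAt_affineOp {Wq : ℝ → Matrix (Fin n) (Fin n) ℝ} {Wq' : Matrix (Fin n) (Fin n) ℝ}
    {c z : ℝ → E n} {c' p : E n} {t : ℝ} (hW : HasDerivAt Wq Wq' t) (hc : HasDerivAt c c' t)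
    (hz : HasDerivAt z p t) :
    HasDerivAt (fun s => affineOp (Wq s) (c s) (z s))
      (affineOp (Wq t) (Wq'.toEuclideanLin (z t) + c') p) t := by
  have h := (hasDerivAt_toEuclideanLin (hW.const_sub 1) hz).sub hc
  refine HasDerivAt.congr_deriv h ?_
  rw [affineOp, map_neg, LinearMap.neg_apply]
  abel

/-! ### Convex hulls of compact sets -/

/-- By Carathéodory's theorem the hull is the continuous image of the compact set of `dim V + 1`
weights and points. -/
theorem _root_.IsCompact.convexHull_of_finiteDimensional {V : Type*} [NormedAddCommGroup V]
    [NormedSpace ℝ V] [FiniteDimensional ℝ V] {s : Set V} (hs : IsCompact s) :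
    IsCompact (convexHull ℝ s) := by
  let ι := Fin (Module.finrank ℝ V + 1)
  let Φ : (ι → ℝ) × (ι → V) → V := fun q => ∑ i, q.1 i • q.2 i
  have hΦ : Continuous Φ := by fun_prop
  have hK := ((isCompact_stdSimplex ℝ ι).prod (isCompact_univ_pi fun _ : ι => hs)).image hΦ
  convert! hK
  apply Set.Subset.antisymm
  · intro x hx
    obtain ⟨κ, _, z, w, hzs, hind, hw, hw1, rfl⟩ := eq_pos_convex_span_of_mem_convexHull hx
    have hcard : Fintype.card κ ≤ Fintype.card ι := by
      have h1 := hind.card_le_finrank_succ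
      have h2 := Submodule.finrank_le (vectorSpan ℝ (Set.range z))
      simp only [ι, Fintype.card_fin]
      lia
    obtain ⟨e⟩ := Function.Embedding.nonempty_of_card_le hcard
    have hκ : Nonempty κ := by
      by_contra h
      rw [not_nonempty_iff] at h
      simp at hw1
    have he := e.injective
    -- A shorter combination is padded with zero weights on an arbitrary one of its points.
    refine ⟨(Function.extend e w 0, Function.extend e z fun _ => z (Classical.arbitrary κ)),
      ⟨⟨fun j => ?_, ?_⟩, fun j _ => ?_⟩, ?_⟩
    · by_cases hj : ∃ i, e i = j
      · obtain ⟨i, rfl⟩ := hj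
        simpa only [he.extend_apply] using (hw i).le
      · simp [Function.extend_apply' _ _ _ hj]
    · rw [← hw1]
      exact (Fintype.sum_of_injective e he w (Function.extend e w 0)
        (fun j hj => Function.extend_apply' w (0 : ι → ℝ) j hj)
        fun i => (he.extend_apply w (0 : ι → ℝ) i).symm).symm
    · by_cases hj : ∃ i, e i = j
      · obtain ⟨i, rfl⟩ := hj
        simpa only [he.extend_apply] using hzs ⟨i, rfl⟩
      · simpa only [Function.extend_apply' _ _ _ hj] using hzs ⟨_, rfl⟩
    · refine (Fintype.sum_of_injective e he _ _ (fun j hj => ?_) fun i => ?_).symm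
      · simp [Function.extend_apply' _ _ _ hj]
      · simp only [he.extend_apply]
  · rintro _ ⟨⟨w, y⟩, ⟨hw, hy⟩, rfl⟩
    exact (convex_convexHull ℝ s).sum_mem (fun i _ => hw.1 i) hw.2
      fun i _ => subset_convexHull ℝ s (hy i trivial)

/-! ### Limiting derivatives -/

/-- The limits of derivatives of `f` along sequences of points converging to `x`. -/
def limitingJacobian (f : E n → E n) (x : E n) : Set (E n →L[ℝ] E n) :=
  {A | ∃ u : ℕ → E n, Tendsto u atTop (𝓝 x) ∧ (∀ k, DifferentiableAt ℝ f (u k)) ∧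
    Tendsto (fun k => fderiv ℝ f (u k)) atTop (𝓝 A)}

theorem clarkeJacobian_eq_convexHull (f : E n → E n) (x : E n) :
    clarkeJacobian f x = convexHull ℝ (limitingJacobian f x) := rfl

/-- Sequential limits are the cluster points of `fderiv ℝ f` along the differentiability points near
`x`, and cluster points form a closed set. -/
theorem isClosed_limitingJacobian (f : E n → E n) (x : E n) :
    IsClosed (limitingJacobian f x) := by
  have : limitingJacobian f x =
      {A | MapClusterPt A (𝓝 x ⊓ 𝓟 {u | DifferentiableAt ℝ f u}) (fderiv ℝ f)} := by
    ext A
    constructor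
    · rintro ⟨u, hu, hd, h⟩
      exact MapClusterPt.of_comp (tendsto_inf.2 ⟨hu, tendsto_principal.2 (.of_forall hd)⟩)
        h.mapClusterPt
    · intro h
      have h' : NeBot ((𝓝 x ⊓ 𝓟 {u | DifferentiableAt ℝ f u}) ⊓ comap (fderiv ℝ f) (𝓝 A)) := by
        rw [Filter.neBot_inf_comap_iff_map]
        rwa [inf_comm]
      obtain ⟨u, hu⟩ := exists_seq_tendsto
        ((𝓝 x ⊓ 𝓟 {u | DifferentiableAt ℝ f u}) ⊓ comap (fderiv ℝ f) (𝓝 A))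
      rw [tendsto_inf, tendsto_inf, tendsto_principal, tendsto_comap_iff] at hu
      obtain ⟨N, hN⟩ := eventually_atTop.1 hu.1.2
      exact ⟨fun k => u (k + N), hu.1.1.comp (tendsto_add_atTop_nat N),
        fun k => hN _ (Nat.le_add_left _ _), hu.2.comp (tendsto_add_atTop_nat N)⟩
  rw [this]
  exact isClosed_setOfPred_clusterPt

theorem isCompact_limitingJacobian {f : E n → E n} {K : NNReal} (hf : LipschitzWith K f)
    (x : E n) : IsCompact (limitingJacobian f x) := by
  refine (isCompact_closedBall (0 : E n →L[ℝ] E n) K).of_isClosed_subset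
    (isClosed_limitingJacobian f x) ?_
  rintro A ⟨u, -, -, h⟩
  refine Metric.isClosed_closedBall.mem_of_tendsto h (.of_forall fun k => ?_)
  rw [mem_closedBall_zero_iff]
  exact norm_fderiv_le_of_lipschitz ℝ hf

theorem isCompact_clarkeJacobian {f : E n → E n} {K : NNReal} (hf : LipschitzWith K f)
    (x : E n) : IsCompact (clarkeJacobian f x) :=
  (isCompact_limitingJacobian hf x).convexHull_of_finiteDimensional

/-- The transfer principle for closed convex properties of nearby derivatives. -/
theorem clarkeJacobian_subset {f : E n → E n} {x : E n} {P : Set (E n →L[ℝ] E n)}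
    (hc : IsClosed P) (hconv : Convex ℝ P)
    (h : ∀ᶠ u in 𝓝 x, DifferentiableAt ℝ f u → fderiv ℝ f u ∈ P) : clarkeJacobian f x ⊆ P := by
  refine convexHull_min ?_ hconv
  rintro A ⟨u, hu, hd, hA⟩
  exact hc.mem_of_tendsto hA ((hu.eventually h).mono fun k hk => hk (hd k))

theorem limitingJacobian_subset_of_eventuallyEq {f g : E n → E n} {x : E n} (h : f =ᶠ[𝓝 x] g) :
    limitingJacobian f x ⊆ limitingJacobian g x := by
  rintro A ⟨u, hu, hd, hA⟩
  obtain ⟨N, hN⟩ := eventually_atTop.1 (hu.eventually h.eventuallyEq_nhds)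
  refine ⟨fun k => u (k + N), hu.comp (tendsto_add_atTop_nat N), fun k => ?_, ?_⟩
  · exact (hN _ (Nat.le_add_left _ _)).differentiableAt_iff.1 (hd _)
  · refine (hA.comp (tendsto_add_atTop_nat N)).congr fun k => ?_
    exact (hN _ (Nat.le_add_left _ _)).fderiv_eq

theorem clarkeJacobian_congr {f g : E n → E n} {x : E n} (h : f =ᶠ[𝓝 x] g) :
    clarkeJacobian f x = clarkeJacobian g x := by
  rw [clarkeJacobian_eq_convexHull, clarkeJacobian_eq_convexHull,
    (limitingJacobian_subset_of_eventuallyEq h).antisymm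
      (limitingJacobian_subset_of_eventuallyEq h.symm)]

/-! ### A mean value inequality for Lipschitz functions -/

/-- The segment from `x` may miss `D` entirely. By Fubini, for almost every `y` the line through `y`
along `p` lies in `D` almost everywhere; there `h` is absolutely continuous and its derivative can
be integrated. Density of such `y` and continuity give the bound at `x`. -/
theorem sub_le_mul_of_ae_lineDeriv_le {h : E n → ℝ} {K : NNReal} (hh : LipschitzWith K h)
    {D : Set (E n)} (hDm : MeasurableSet D)
    (hD : ∀ᵐ u : E n, u ∈ D)
    {x p : E n} {δ c : ℝ}
    (hle : ∀ u ∈ D, u ∈ Metric.ball x δ → ∃ d ≤ c, HasLineDerivAt ℝ h d u p)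
    {s : ℝ} (hs : 0 ≤ s) (hsp : s * ‖p‖ < δ) : h (x + s • p) - h x ≤ c * s := by
  have hae := (MeasureTheory.ae_ae_add_linearMap_mem_iff (LinearMap.toSpanSingleton ℝ (E n) p)
    (MeasureTheory.volume : MeasureTheory.Measure ℝ) MeasureTheory.volume hDm).2 hD
  have hdense := MeasureTheory.Measure.dense_of_ae hae
  -- The radius is reduced by `s * ‖p‖` so that the whole segment from `y` stays in the `δ`-ball.
  have hgood : ∀ y, (∀ᵐ t : ℝ, y + t • p ∈ D) → y ∈ Metric.ball x (δ - s * ‖p‖) →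
      h (y + s • p) - h y ≤ c * s := by
    intro y hy hyx
    have hφ : LipschitzWith (K * ‖p‖₊) fun t : ℝ => h (y + t • p) := by
      refine hh.comp (LipschitzWith.of_dist_le_mul fun a b => ?_)
      rw [dist_add_left, dist_eq_norm, ← sub_smul, norm_smul, mul_comm, coe_nnnorm, dist_eq_norm]
    have hac : AbsolutelyContinuousOnInterval (fun t : ℝ => h (y + t • p)) 0 s :=
      (hφ.lipschitzOnWith).absolutelyContinuousOnInterval
    have hint := hac.integral_deriv_eq_sub
    simp only [zero_smul, add_zero] at hint
    rw [← hint]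
    have hc : ∫ _ in (0 : ℝ)..s, c = c * s := by simp [mul_comm]
    rw [← hc]
    refine intervalIntegral.integral_mono_ae_restrict hs hac.intervalIntegrable_deriv
      intervalIntegrable_const ?_
    rw [Filter.EventuallyLE, MeasureTheory.ae_restrict_iff' measurableSet_Icc]
    filter_upwards [hy] with t ht hts
    obtain ⟨d, hd, hder⟩ := hle _ ht (by
      rw [mem_ball_iff_norm] at hyx ⊢
      calc ‖y + t • p - x‖ = ‖(y - x) + t • p‖ := by congr 1; abel
        _ ≤ ‖y - x‖ + t * ‖p‖ := by
          refine (norm_add_le _ _).trans ?_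
          rw [norm_smul, Real.norm_eq_abs, abs_of_nonneg hts.1]
        _ ≤ ‖y - x‖ + s * ‖p‖ := by gcongr; exact hts.2
        _ < δ := by linarith)
    have : HasDerivAt (fun τ : ℝ => h (y + τ • p)) d t := by
      have h1 : HasDerivAt (fun τ : ℝ => h (y + t • p + τ • p)) d (t - t) := by
        rw [sub_self]; exact hder
      have h2 := h1.comp_sub_const t t
      refine h2.congr_of_eventuallyEq (.of_forall fun τ => ?_)
      simp only
      congr 1
      module
    rw [this.deriv]
    exact hd
  by_contra! hcon
  have hopen : ∀ᶠ y in 𝓝 x, c * s < h (y + s • p) - h y :=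
    ((by have := hh.continuous; fun_prop : Continuous fun y => h (y + s • p) - h y).tendsto
      x).eventually (lt_mem_nhds hcon)
  have hfreq := mem_closure_iff_frequently.1 (hdense x)
  obtain ⟨y, hy, hy1, hy2⟩ := (hfreq.and_eventually
    (hopen.and (Metric.ball_mem_nhds x (by linarith : 0 < δ - s * ‖p‖)))).exists
  exact absurd (hgood y hy hy2) (not_le.2 hy1)

/-! ### Directional derivatives and Clarke's Jacobian -/

/-- Violations at points tending to `x` would, by boundedness of the derivatives, have a
subsequential limit in the limiting Jacobian that also violates the bound. -/
theorem eventually_lt_of_forall_limitingJacobian {f : E n → E n} {K : NNReal}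
    (hf : LipschitzWith K f) {x p : E n} {ℓ : E n →L[ℝ] ℝ} {c : ℝ}
    (h : ∀ A ∈ limitingJacobian f x, ℓ (A p) < c) :
    ∀ᶠ u in 𝓝 x, DifferentiableAt ℝ f u → ℓ (fderiv ℝ f u p) < c := by
  by_contra hcon
  obtain ⟨u, hu, hu'⟩ := exists_seq_forall_of_frequently (not_eventually.1 hcon)
  simp only [Classical.not_imp, not_lt] at hu'
  obtain ⟨A, -, φ, hφ, hA⟩ := (isCompact_closedBall (0 : E n →L[ℝ] E n) K).tendsto_subseq
    (x := fun k => fderiv ℝ f (u k)) fun k => by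
      rw [mem_closedBall_zero_iff]; exact norm_fderiv_le_of_lipschitz ℝ hf
  have hAp : Tendsto (fun k => ℓ (fderiv ℝ f (u (φ k)) p)) atTop (𝓝 (ℓ (A p))) :=
    (ℓ.continuous.tendsto _).comp
      (((ContinuousLinearMap.apply ℝ (E n) p).continuous.tendsto A).comp hA)
  refine absurd (h A ⟨u ∘ φ, hu.comp hφ.tendsto_atTop, fun k => (hu' _).1, hA⟩) (not_lt.2 ?_)
  exact ge_of_tendsto' hAp fun k => (hu' _).2

/-- A directional derivative of a Lipschitz map is the image of the direction under an element of
Clarke's generalized Jacobian. -/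
theorem exists_mem_clarkeJacobian_of_tendsto {f : E n → E n} {K : NNReal}
    (hf : LipschitzWith K f) {x p v : E n}
    (hv : Tendsto (fun s : ℝ => s⁻¹ • (f (x + s • p) - f x)) (𝓝[>] 0) (𝓝 v)) :
    ∃ A ∈ clarkeJacobian f x, A p = v := by
  by_contra hcon
  let ev := ContinuousLinearMap.apply ℝ (E n) p
  have hK : IsCompact (ev '' clarkeJacobian f x) :=
    (isCompact_clarkeJacobian hf x).image ev.continuous
  have hKc : Convex ℝ (ev '' clarkeJacobian f x) :=
    (convex_convexHull ℝ _).linear_image ev.toLinearMap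
  -- Here `ℓ (A p) < c < ℓ v` for all Clarke elements `A`; the mean value inequality for `ℓ ∘ f`
  -- will force `ℓ v ≤ c`.
  obtain ⟨ℓ, c, hℓ, hℓv⟩ := geometric_hahn_banach_closed_point hKc hK.isClosed
    (x := v) (fun ⟨A, hA, e⟩ => hcon ⟨A, hA, e⟩)
  have hev := eventually_lt_of_forall_limitingJacobian hf (x := x) (p := p) (ℓ := ℓ) (c := c)
    fun A hA => hℓ _ ⟨A, subset_convexHull ℝ _ hA, rfl⟩
  obtain ⟨δ, hδ, hball⟩ := Metric.eventually_nhds_iff_ball.1 hev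
  have hlip : LipschitzWith (‖ℓ‖₊ * K) (ℓ ∘ f) := ℓ.lipschitz.comp hf
  have hmv : ∀ s : ℝ, 0 ≤ s → s * ‖p‖ < δ → ℓ (f (x + s • p)) - ℓ (f x) ≤ c * s :=
    fun s hs hsp => sub_le_mul_of_ae_lineDeriv_le hlip (measurableSet_of_differentiableAt ℝ f)
      hf.ae_differentiableAt (fun u hu hux => ⟨_, (hball u hux hu).le,
        (ℓ.hasFDerivAt.comp u hu.hasFDerivAt).hasLineDerivAt p⟩) hs hsp
  have hlim : Tendsto (fun s : ℝ => ℓ (s⁻¹ • (f (x + s • p) - f x))) (𝓝[>] 0) (𝓝 (ℓ v)) :=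
    (ℓ.continuous.tendsto _).comp hv
  refine absurd hℓv (not_lt.2 (le_of_tendsto hlim ?_))
  have hsmall : ∀ᶠ s : ℝ in 𝓝[>] 0, s * ‖p‖ < δ := by
    refine nhdsWithin_le_nhds (((by fun_prop : Continuous fun s : ℝ => s * ‖p‖).tendsto
      0).eventually (gt_mem_nhds ?_))
    simpa using hδ
  filter_upwards [hsmall, self_mem_nhdsWithin] with s hs hs0
  have hs0 : 0 < s := hs0
  rw [map_smul, map_sub, smul_eq_mul, inv_mul_le_iff₀ hs0, mul_comm s]
  exact hmv s hs0.le hs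

/-- A chain rule for Clarke's generalized Jacobian along curves. -/
theorem exists_mem_clarkeJacobian_of_hasDerivAt {f : E n → E n} {K : NNReal}
    (hf : LipschitzWith K f) {y : ℝ → E n} {t : ℝ} {p v : E n} (hy : HasDerivAt y p t)
    (hfy : HasDerivAt (fun s => f (y s)) v t) : ∃ A ∈ clarkeJacobian f (y t), A p = v := by
  refine exists_mem_clarkeJacobian_of_tendsto hf ?_
  have h1 := hfy.tendsto_slope_zero_right
  have h2 : Tendsto (fun s : ℝ => ‖p - s⁻¹ • (y (t + s) - y t)‖) (𝓝[>] 0) (𝓝 0) := by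
    simpa using (hy.tendsto_slope_zero_right.const_sub p).norm
  -- By the Lipschitz bound, replacing the curve by its tangent line changes the difference quotient
  -- by at most `K` times an error tending to zero.
  have h3 : Tendsto (fun s : ℝ => s⁻¹ • (f (y t + s • p) - f (y (t + s)))) (𝓝[>] 0) (𝓝 0) := by
    refine squeeze_zero_norm' ?_ (by simpa using h2.const_mul (K : ℝ))
    filter_upwards [self_mem_nhdsWithin] with s hs
    have hs : 0 < s := hs
    have e : y t + s • p - y (t + s) = s • (p - s⁻¹ • (y (t + s) - y t)) := by
      rw [smul_sub, smul_inv_smul₀ hs.ne']; abel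
    have h4 := hf.dist_le_mul (y t + s • p) (y (t + s))
    rw [dist_eq_norm, dist_eq_norm, e, norm_smul, Real.norm_eq_abs, abs_of_pos hs] at h4
    rw [norm_smul, norm_inv, Real.norm_eq_abs, abs_of_pos hs, inv_mul_le_iff₀ hs]
    linarith
  have h5 := h3.add h1
  rw [zero_add] at h5
  refine h5.congr fun s => ?_
  rw [← smul_add, sub_add_sub_cancel]

/-! ### Derivatives of monotone maps -/

theorem tendsto_slope_fderiv {f : E n → E n} {u : E n} (hu : DifferentiableAt ℝ f u) (v : E n) :
    Tendsto (fun s : ℝ => s⁻¹ • (f (u + s • v) - f u)) (𝓝[>] 0) (𝓝 (fderiv ℝ f u v)) := by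
  have h : HasDerivAt (fun s : ℝ => f (u + s • v)) (fderiv ℝ f u v) 0 :=
    hu.hasFDerivAt.hasLineDerivAt v
  simpa using h.tendsto_slope_zero_right

theorem eventually_add_smul_mem {N : Set (E n)} {u : E n} (hN : N ∈ 𝓝 u) (v : E n) :
    ∀ᶠ s : ℝ in 𝓝[>] 0, u + s • v ∈ N := by
  have h : Tendsto (fun s : ℝ => u + s • v) (𝓝 0) (𝓝 u) := by
    simpa using (by fun_prop : Continuous fun s : ℝ => u + s • v).tendsto 0
  exact nhdsWithin_le_nhds (h.eventually hN)

theorem inner_fderiv_nonneg {f : E n → E n} {N : Set (E n)} {u : E n} (hN : N ∈ 𝓝 u)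
    (hf : ∀ a ∈ N, ∀ b ∈ N, 0 ≤ inner ℝ (f a - f b) (a - b)) (hu : DifferentiableAt ℝ f u)
    (v : E n) : 0 ≤ inner ℝ (fderiv ℝ f u v) v := by
  refine ge_of_tendsto ((tendsto_slope_fderiv hu v).inner tendsto_const_nhds) ?_
  filter_upwards [eventually_add_smul_mem hN v, self_mem_nhdsWithin] with s hs hs0
  have hs0 : 0 < s := hs0
  have h := hf _ hs _ (mem_of_mem_nhds hN)
  rw [add_sub_cancel_left, inner_smul_right] at h
  rw [inner_smul_left, conj_trivial]
  exact mul_nonneg (inv_nonneg.2 hs0.le) (nonneg_of_mul_nonneg_right h hs0)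

theorem norm_sq_fderiv_le_inner {f : E n → E n}
    (hf : ∀ a b, ‖f a - f b‖ ^ 2 ≤ inner ℝ (f a - f b) (a - b)) {u : E n}
    (hu : DifferentiableAt ℝ f u) (v : E n) :
    ‖fderiv ℝ f u v‖ ^ 2 ≤ inner ℝ (fderiv ℝ f u v) v := by
  have hlim := tendsto_slope_fderiv hu v
  refine le_of_tendsto_of_tendsto (hlim.norm.pow 2) (hlim.inner tendsto_const_nhds) ?_
  filter_upwards [self_mem_nhdsWithin] with s hs0
  have hs0 : 0 < s := hs0
  have h := hf (u + s • v) u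
  rw [add_sub_cancel_left, inner_smul_right] at h
  rw [inner_smul_left, conj_trivial, norm_smul, norm_inv, Real.norm_eq_abs, abs_of_pos hs0,
    mul_pow, inv_pow, inv_mul_le_iff₀ (by positivity)]
  refine h.trans_eq ?_
  field_simp

theorem symNonneg_iff (A : E n →L[ℝ] E n) : SymNonneg A ↔ ∀ v, 0 ≤ inner ℝ (A v) v := by
  have hin : ∀ v, ((1 / 2 : ℝ) • (A + ContinuousLinearMap.adjoint A)).reApplyInnerSelf v =
      inner ℝ (A v) v := by
    intro v
    rw [ContinuousLinearMap.reApplyInnerSelf_apply, smul_apply,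
      add_apply, inner_smul_left, inner_add_left,
      ContinuousLinearMap.adjoint_inner_left, real_inner_comm (A v) v]
    simp only [conj_trivial, RCLike.re_to_real]
    ring
  rw [SymNonneg, ContinuousLinearMap.isPositive_def]
  simp only [hin]
  refine and_iff_right fun a b => ?_
  simp only [ContinuousLinearMap.coe_coe, smul_apply,
    add_apply, inner_smul_left, inner_smul_right, inner_add_left,
    inner_add_right, ContinuousLinearMap.adjoint_inner_left,
    ContinuousLinearMap.adjoint_inner_right, conj_trivial]
  ring

theorem isClosed_setOf_inner_nonneg :
    IsClosed {A : E n →L[ℝ] E n | ∀ v, 0 ≤ inner ℝ (A v) v} := by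
  simp only [Set.ofPred_forall]
  exact isClosed_iInter fun v => isClosed_le continuous_const (by fun_prop)

theorem convex_setOf_inner_nonneg :
    Convex ℝ {A : E n →L[ℝ] E n | ∀ v, 0 ≤ inner ℝ (A v) v} := by
  intro A hA B hB s t hs ht _ v
  rw [add_apply, smul_apply,
    smul_apply, inner_add_left, inner_smul_left, inner_smul_left,
    conj_trivial, conj_trivial]
  exact add_nonneg (mul_nonneg hs (hA v)) (mul_nonneg ht (hB v))

theorem isClosed_setOf_norm_sq_le_inner :
    IsClosed {A : E n →L[ℝ] E n | ∀ v, ‖A v‖ ^ 2 ≤ inner ℝ (A v) v} := by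
  simp only [Set.ofPred_forall]
  exact isClosed_iInter fun v => isClosed_le (by fun_prop) (by fun_prop)

theorem convex_setOf_norm_sq_le_inner :
    Convex ℝ {A : E n →L[ℝ] E n | ∀ v, ‖A v‖ ^ 2 ≤ inner ℝ (A v) v} := by
  intro A hA B hB s t hs ht hst v
  obtain rfl : t = 1 - s := by linarith
  -- Exact convexity defect of the squared norm; the other side of the condition is linear in the
  -- operator.
  have h : ‖s • A v + (1 - s) • B v‖ ^ 2 =
      s * ‖A v‖ ^ 2 + (1 - s) * ‖B v‖ ^ 2 - s * (1 - s) * ‖A v - B v‖ ^ 2 := by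
    rw [norm_add_sq_real, norm_sub_sq_real, norm_smul, norm_smul, inner_smul_left,
      inner_smul_right, mul_pow, mul_pow, Real.norm_eq_abs, Real.norm_eq_abs, sq_abs, sq_abs,
      conj_trivial]
    ring
  rw [add_apply, smul_apply,
    smul_apply, h, inner_add_left, inner_smul_left, inner_smul_left,
    conj_trivial, conj_trivial]
  have h1 := mul_le_mul_of_nonneg_left (hA v) hs
  have h2 := mul_le_mul_of_nonneg_left (hB v) ht
  have h3 : 0 ≤ s * (1 - s) * ‖A v - B v‖ ^ 2 := by positivity
  linarith

theorem IsMonotoneOp.symNonneg_of_mem_clarkeJacobian {G : E n → Set (E n)} (hG : IsMonotoneOp G)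
    {f : E n → E n} {z : E n} (hf : IsLipschitzNear G f z) {A : E n →L[ℝ] E n}
    (hA : A ∈ clarkeJacobian f z) : SymNonneg A := by
  obtain ⟨K, N, hN, -, hGf⟩ := hf
  refine (symNonneg_iff A).2 (clarkeJacobian_subset isClosed_setOf_inner_nonneg
    convex_setOf_inner_nonneg ?_ hA)
  filter_upwards [eventually_mem_nhds_iff.2 hN] with u hu hd v
  refine inner_fderiv_nonneg hu (fun a ha b hb => ?_) hd v
  exact hG a b _ (by rw [hGf a ha]; rfl) _ (by rw [hGf b hb]; rfl)

theorem norm_sq_le_inner_of_mem_clarkeJacobian_res {G : E n → Set (E n)} (hG : IsMonotoneOp G)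
    {β : ℝ} (hβ : 0 < β) (hres : HasResolvent β G) {y : E n} {D : E n →L[ℝ] E n}
    (hD : D ∈ clarkeJacobian (res β G) y) (v : E n) : ‖D v‖ ^ 2 ≤ inner ℝ (D v) v :=
  clarkeJacobian_subset isClosed_setOf_norm_sq_le_inner convex_setOf_norm_sq_le_inner
    (.of_forall fun _ hd => norm_sq_fderiv_le_inner (norm_sq_res_sub_le hβ hG hres) hd) hD v

theorem lipschitzWith_res {G : E n → Set (E n)} (hG : IsMonotoneOp G) {β : ℝ} (hβ : 0 < β)
    (hres : HasResolvent β G) : LipschitzWith 1 (res β G) :=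
  LipschitzWith.of_dist_le_mul fun y y' => by
    simpa [dist_eq_norm] using norm_res_sub_le hβ hG hres y y'

theorem IsLipschitzNear.exists_mem_clarkeJacobian {G : E n → Set (E n)} {f : E n → E n}
    {y : ℝ → E n} {t : ℝ} (hf : IsLipschitzNear G f (y t)) {p v : E n} (hy : HasDerivAt y p t)
    (hfy : HasDerivAt (fun s => f (y s)) v t) : ∃ A ∈ clarkeJacobian f (y t), A p = v := by
  obtain ⟨K, N, hN, hK, -⟩ := hf
  -- The chain rule needs a globally Lipschitz map; an extension that agrees with `f` near the point
  -- has the same Clarke Jacobian there.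
  obtain ⟨g, hg, hfg⟩ := hK.extend_finite_dimension
  have hev : f =ᶠ[𝓝 (y t)] g := Filter.mem_of_superset hN fun u hu => hfg hu
  rw [clarkeJacobian_congr hev]
  refine exists_mem_clarkeJacobian_of_hasDerivAt hg hy (hfy.congr_of_eventuallyEq ?_)
  exact (hy.continuousAt.eventually hev).mono fun s hs => hs.symm

/-! ### Linear operators of the backward pass -/

theorem SymNonneg.isMonotoneOp {A : E n →L[ℝ] E n} (hA : SymNonneg A) :
    IsMonotoneOp (single A) := by
  rintro x y _ rfl _ rfl
  rw [← map_sub]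
  exact (symNonneg_iff A).1 hA _

theorem SymNonneg.hasResolvent {A : E n →L[ℝ] E n} (hA : SymNonneg A) {α : ℝ} (hα : 0 < α) :
    HasResolvent α (single A) := by
  simpa using hasResolvent_single_of_linear (B := A.toLinearMap) ((symNonneg_iff A).1 hA) 0 hα

theorem isMonotoneOp_opOfResolvent {D : E n →L[ℝ] E n} (hD : ∀ v, ‖D v‖ ^ 2 ≤ inner ℝ (D v) v)
    {β : ℝ} (hβ : 0 < β) : IsMonotoneOp (opOfResolvent β D) := by
  intro x y u hu v hv
  change D (x + β • u) = x at hu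
  change D (y + β • v) = y at hv
  have h := hD ((x + β • u) - (y + β • v))
  have e : (x + β • u) - (y + β • v) = (x - y) + β • (u - v) := by module
  rw [map_sub, hu, hv, e, inner_add_right, real_inner_self_eq_norm_sq, inner_smul_right,
    real_inner_comm] at h
  exact nonneg_of_mul_nonneg_right (by linarith) hβ

/-- `D` need not be invertible, but the pairs `(D w, β⁻¹(w - D w))` lie in the graph, so it suffices
to solve `(D + (α/β)(I - D)) w = y`. This map is injective because `⟨D w, w - D w⟩ ≥ 0`. -/
theorem hasResolvent_opOfResolvent {D : E n →L[ℝ] E n}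
    (hD : ∀ v, ‖D v‖ ^ 2 ≤ inner ℝ (D v) v) {β : ℝ} (hβ : 0 < β) {α : ℝ} (hα : 0 < α) :
    HasResolvent α (opOfResolvent β D) := by
  refine (isMonotoneOp_opOfResolvent hD hβ).hasResolvent hα fun y => ?_
  have hk : 0 < α / β := by positivity
  have hinj : Function.Injective
      (D.toLinearMap + (α / β) • (LinearMap.id - D.toLinearMap) : E n →ₗ[ℝ] E n) := by
    rw [← LinearMap.ker_eq_bot, LinearMap.ker_eq_bot']
    intro w hw
    have hw : D w + (α / β) • (w - D w) = 0 := hw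
    have h1 : D w = -((α / β) • (w - D w)) := eq_neg_of_add_eq_zero_left hw
    have h2 : 0 ≤ inner ℝ (D w) (w - D w) := by
      rw [inner_sub_right, real_inner_self_eq_norm_sq]
      linarith [hD w]
    rw [h1, inner_neg_left, ← h1, inner_smul_left, real_inner_self_eq_norm_sq,
      conj_trivial] at h2
    have h3 : ‖w - D w‖ ^ 2 = 0 := by nlinarith [sq_nonneg ‖w - D w‖]
    rw [pow_eq_zero_iff two_ne_zero, norm_eq_zero] at h3
    rw [h3, smul_zero, neg_zero] at h1
    rwa [h1, sub_zero] at h3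
  obtain ⟨w, hw⟩ := LinearMap.injective_iff_surjective.1 hinj y
  have hw : D w + (α / β) • (w - D w) = y := hw
  refine ⟨D w, β⁻¹ • (w - D w), ?_, ?_⟩
  · change D (D w + β • β⁻¹ • (w - D w)) = D w
    rw [smul_inv_smul₀ hβ.ne', add_sub_cancel]
  · rw [smul_smul, ← div_eq_mul_inv, hw]

/-! ### Sensitivity of the equilibrium -/

theorem SolvesInclusion.eq_of_eq_singleton {F f : E n → E n} {G : E n → Set (E n)} {z : E n}
    (h : SolvesInclusion F G z) (hf : G z = {f z}) : f z = -F z := by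
  obtain ⟨g, hg, e⟩ := h
  rw [hf] at hg
  rw [← Set.mem_singleton_iff.1 hg]
  exact eq_neg_of_add_eq_zero_right e

theorem SolvesInclusion.res_eq {F : E n → E n} {G : E n → Set (E n)} {z : E n} {β : ℝ}
    (h : SolvesInclusion F G z) (hres : HasResolvent β G) : res β G (z - β • F z) = z := by
  obtain ⟨g, hg, e⟩ := h
  refine hres.res_eq ⟨g, hg, ?_⟩
  rw [eq_neg_of_add_eq_zero_right e]
  module

/-- The derivative of a solution curve of `0 ∈ F_t(z) + G(z)`, for `G` locally a Lipschitz map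
`f`, solves an inclusion linearized by an element of Clarke's generalized Jacobian of `f`. -/
theorem exists_mem_clarkeJacobian_solvesInclusion {G : E n → Set (E n)} {F : ℝ → E n → E n}
    {F' : E n → E n} {f : E n → E n} {z : ℝ → E n} {p : E n} {t : ℝ}
    (hz : ∀ᶠ s in 𝓝 t, SolvesInclusion (F s) G (z s)) (hp : HasDerivAt z p t)
    (hF : HasDerivAt (fun s => F s (z s)) (F' p) t) (hf : IsLipschitzNear G f (z t)) :
    ∃ A ∈ clarkeJacobian f (z t), SolvesInclusion F' (single A) p := by
  obtain ⟨K, N, hN, -, hGf⟩ := id hf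
  -- The inclusion identifies `f (z s)` with `-F s (z s)`, which is differentiable even if `f` is
  -- not.
  have hfz : HasDerivAt (fun s => f (z s)) (-F' p) t := by
    refine hF.neg.congr_of_eventuallyEq ?_
    filter_upwards [hz, hp.continuousAt.eventually hN] with s hs hsN
    exact hs.eq_of_eq_singleton (hGf _ hsN)
  obtain ⟨A, hA, e⟩ := hf.exists_mem_clarkeJacobian hp hfz
  exact ⟨A, hA, A p, rfl, by rw [e, add_neg_cancel]⟩

/-- The derivative of a solution curve of `0 ∈ F_t(z) + G(z)` solves an inclusion linearized by an
element of Clarke's generalized Jacobian of a resolvent of `G`. -/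
theorem exists_mem_clarkeJacobian_res_solvesInclusion {G : E n → Set (E n)} {F : ℝ → E n → E n}
    {F' : E n → E n} {z : ℝ → E n} {p : E n} {t : ℝ}
    (hz : ∀ᶠ s in 𝓝 t, SolvesInclusion (F s) G (z s)) (hp : HasDerivAt z p t)
    (hF : HasDerivAt (fun s => F s (z s)) (F' p) t) (hG : IsMonotoneOp G) {β : ℝ} (hβ : 0 < β)
    (hres : HasResolvent β G) :
    ∃ D ∈ clarkeJacobian (res β G) (z t - β • F t (z t)),
      SolvesInclusion F' (opOfResolvent β D) p := by
  have hy : HasDerivAt (fun s => z s - β • F s (z s)) (p - β • F' p) t :=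
    hp.sub (hF.const_smul β)
  -- The resolvent returns `z s` itself, so its derivative along this curve is `p`.
  have hry : HasDerivAt (fun s => res β G (z s - β • F s (z s))) p t := by
    refine hp.congr_of_eventuallyEq ?_
    filter_upwards [hz] with s hs
    exact hs.res_eq hres
  obtain ⟨D, hD, e⟩ := exists_mem_clarkeJacobian_of_hasDerivAt
    (lipschitzWith_res hG hβ hres) hy hry
  refine ⟨D, hD, -F' p, ?_, add_neg_cancel _⟩
  change D (p + β • -F' p) = p
  rw [smul_neg, ← sub_eq_add_neg, e]

end MonDEQ

theorem mainTheorem5 {n d : ℕ}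
    -- the maximal monotone operator, the input, and the base value of the scalar parameter
    (G : MonDEQ.E n → Set (MonDEQ.E n)) (hG : MonDEQ.IsMaximalMonotoneOp G)
    (x : MonDEQ.E d) (t₀ : ℝ)
    -- weights, their perturbation, the quantized weights, the other parameters
    (W ΔW Wq : ℝ → Matrix (Fin n) (Fin n) ℝ) (hWq : ∀ t, Wq t = W t + ΔW t)
    (U : ℝ → Matrix (Fin n) (Fin d) ℝ) (b : ℝ → MonDEQ.E n)
    -- derivatives of the parameters at the base value
    (Wq' : Matrix (Fin n) (Fin n) ℝ) (U' : Matrix (Fin n) (Fin d) ℝ) (b' : MonDEQ.E n)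
    (hWq' : HasDerivAt Wq Wq' t₀) (hU' : HasDerivAt U U' t₀) (hb' : HasDerivAt b b' t₀)
    -- the quantized equilibrium, its sensitivity, and the source term of the backward inclusion
    (z : ℝ → MonDEQ.E n)
    (hz : ∀ᶠ t in 𝓝 t₀, MonDEQ.SolvesInclusion
      (MonDEQ.affineOp (Wq t) ((U t).toEuclideanLin x + b t)) G (z t))
    (p : MonDEQ.E n) (hp : HasDerivAt z p t₀)
    (r : MonDEQ.E n) (hr : r = Wq'.toEuclideanLin (z t₀) + U'.toEuclideanLin x + b') :
    -- the constants of the quantized operator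
    (MonDEQ.margin (W t₀) - ‖ΔW t₀‖ ≤ MonDEQ.margin (Wq t₀) ∧
      |MonDEQ.lipConst (W t₀) - ‖ΔW t₀‖| ≤ MonDEQ.lipConst (Wq t₀) ∧
      MonDEQ.lipConst (Wq t₀) ≤ MonDEQ.lipConst (W t₀) + ‖ΔW t₀‖) ∧
    (‖ΔW t₀‖ < MonDEQ.margin (W t₀) → 0 < MonDEQ.margin (Wq t₀)) ∧
    -- a positive quantized margin suffices for both passes
    (0 < MonDEQ.margin (Wq t₀) →
      -- forward pass
      MonDEQ.SplittingConverges
        (MonDEQ.affineOp (Wq t₀) ((U t₀).toEuclideanLin x + b t₀)) G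
        (MonDEQ.margin (Wq t₀)) (MonDEQ.lipConst (Wq t₀)) (z t₀) ∧
      -- backward pass when `G` is a Lipschitz map `f` near the equilibrium
      (∀ f : MonDEQ.E n → MonDEQ.E n, MonDEQ.IsLipschitzNear G f (z t₀) →
        (∃ A ∈ MonDEQ.clarkeJacobian f (z t₀), MonDEQ.SymNonneg A ∧
          MonDEQ.SolvesInclusion (MonDEQ.affineOp (Wq t₀) r) (MonDEQ.single A) p ∧
          MonDEQ.SplittingConverges (MonDEQ.affineOp (Wq t₀) r) (MonDEQ.single A)
            (MonDEQ.margin (Wq t₀)) (MonDEQ.lipConst (Wq t₀)) p) ∧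
        (∀ A ∈ MonDEQ.clarkeJacobian f (z t₀), MonDEQ.SymNonneg A ∧
          ∃ q, MonDEQ.SplittingConverges (MonDEQ.affineOp (Wq t₀) r) (MonDEQ.single A)
            (MonDEQ.margin (Wq t₀)) (MonDEQ.lipConst (Wq t₀)) q)) ∧
      -- backward pass for set-valued `G`, linearized through its resolvent
      (∀ β : ℝ, 0 < β → MonDEQ.HasResolvent β G ∧
        ∀ y : MonDEQ.E n,
          y = z t₀ - β • MonDEQ.affineOp (Wq t₀) ((U t₀).toEuclideanLin x + b t₀) (z t₀) →
          (∃ D ∈ MonDEQ.clarkeJacobian (MonDEQ.res β G) y,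
            MonDEQ.IsMonotoneOp (MonDEQ.opOfResolvent β D) ∧
            MonDEQ.SolvesInclusion (MonDEQ.affineOp (Wq t₀) r) (MonDEQ.opOfResolvent β D) p ∧
            MonDEQ.SplittingConverges (MonDEQ.affineOp (Wq t₀) r) (MonDEQ.opOfResolvent β D)
              (MonDEQ.margin (Wq t₀)) (MonDEQ.lipConst (Wq t₀)) p) ∧
          (∀ D ∈ MonDEQ.clarkeJacobian (MonDEQ.res β G) y,
            MonDEQ.IsMonotoneOp (MonDEQ.opOfResolvent β D) ∧
            ∃ q, MonDEQ.SplittingConverges (MonDEQ.affineOp (Wq t₀) r)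
              (MonDEQ.opOfResolvent β D)
              (MonDEQ.margin (Wq t₀)) (MonDEQ.lipConst (Wq t₀)) q))) := by
  have hc : HasDerivAt (fun t => (U t).toEuclideanLin x + b t) (U'.toEuclideanLin x + b') t₀ := by
    have h := (MonDEQ.hasDerivAt_toEuclideanLin hU' (hasDerivAt_const t₀ x)).add hb'
    refine HasDerivAt.congr_deriv h ?_
    rw [map_zero, add_zero]
  -- By the product rule the derivative is `(I - Wq)p - Wq' z - (U'x + b')`, that is, `(I - Wq)p -
  -- r`.
  have hF : HasDerivAt
      (fun t => MonDEQ.affineOp (Wq t) ((U t).toEuclideanLin x + b t) (z t))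
      (MonDEQ.affineOp (Wq t₀) r p) t₀ := by
    rw [hr, add_assoc]
    exact MonDEQ.hasDerivAt_affineOp hWq' hc hp
  have hmargin := MonDEQ.margin_sub_norm_le (W t₀) (ΔW t₀)
  rw [← hWq] at hmargin
  refine ⟨⟨hmargin, ?_, ?_⟩, fun h => by linarith, fun hm => ⟨?_, fun f hf => ⟨?_, ?_⟩, ?_⟩⟩
  · rw [hWq]
    exact MonDEQ.abs_lipConst_sub_norm_le _ _
  · rw [hWq]
    exact MonDEQ.lipConst_add_le _ _
  · exact MonDEQ.splittingConverges_affineOp hm hG.1 (fun _ => hG.hasResolvent)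
      hz.self_of_nhds
  · obtain ⟨A, hA, hAp⟩ := MonDEQ.exists_mem_clarkeJacobian_solvesInclusion hz hp hF hf
    have hAs := hG.1.symNonneg_of_mem_clarkeJacobian hf hA
    exact ⟨A, hA, hAs, hAp, MonDEQ.splittingConverges_affineOp hm hAs.isMonotoneOp
      (fun _ => hAs.hasResolvent) hAp⟩
  · intro A hA
    have hAs := hG.1.symNonneg_of_mem_clarkeJacobian hf hA
    exact ⟨hAs, MonDEQ.exists_splittingConverges_affineOp hm r hAs.isMonotoneOp
      fun _ => hAs.hasResolvent⟩
  · intro β hβ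
    have hres := hG.hasResolvent hβ
    refine ⟨hres, ?_⟩
    rintro y rfl
    refine ⟨?_, fun D hD => ?_⟩
    · obtain ⟨D, hD, hDp⟩ :=
        MonDEQ.exists_mem_clarkeJacobian_res_solvesInclusion hz hp hF hG.1 hβ hres
      have hDf := MonDEQ.norm_sq_le_inner_of_mem_clarkeJacobian_res hG.1 hβ hres hD
      have hDm := MonDEQ.isMonotoneOp_opOfResolvent hDf hβ
      exact ⟨D, hD, hDm, hDp, MonDEQ.splittingConverges_affineOp hm hDm
        (fun _ => MonDEQ.hasResolvent_opOfResolvent hDf hβ) hDp⟩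
    · have hDf := MonDEQ.norm_sq_le_inner_of_mem_clarkeJacobian_res hG.1 hβ hres hD
      have hDm := MonDEQ.isMonotoneOp_opOfResolvent hDf hβ
      exact ⟨hDm, MonDEQ.exists_splittingConverges_affineOp hm r hDm
        fun _ => MonDEQ.hasResolvent_opOfResolvent hDf hβ⟩
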